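/- **Theorem.** All graphs are finite, simple and undirected; $MM(G)$ denotes the number of edges of a maximum matching of $G$. For every real $\lambda>1$ and every integer $k\ge 0$ there exist graphs $G$ and $H$ with $MM(H)\ge 1$ and $$MM(G)\ \ge\ \lambda\cdot MM(H)$$ such that for every graph $K$ with at most $k$ edges (isolated vertices allowed), the number of (not necessarily induced) subgraphs of $G$ isomorphic to $K$ equals the number of subgraphs of $H$ isomorphic to $K$. Here a subgraph of $G=(V,E)$ is a pair $(V',E')$ with $V'\subseteq V$ and $E'\subseteq E$ such that every edge in $E'$ has both endpoints in $V'$. -/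

import Mathlib

namespace SimpleGraph

/-- The matching number of a finite graph: the largest number of edges of a matching of `G`. -/
noncomputable def matchingNumber {V : Type*} [Fintype V] (G : SimpleGraph V) : ℕ :=
  sSup {m : ℕ | ∃ M : G.Subgraph, M.IsMatching ∧ M.edgeSet.ncard = m}

/-- The supremum that defines the matching number is a maximum. -/
theorem isGreatest_matchingNumber {V : Type*} [Fintype V] (G : SimpleGraph V) :
    IsGreatest {m : ℕ | ∃ M : G.Subgraph, M.IsMatching ∧ M.edgeSet.ncard = m}
      G.matchingNumber := by
  have hne : {m : ℕ | ∃ M : G.Subgraph, M.IsMatching ∧ M.edgeSet.ncard = m}.Nonempty :=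
    ⟨0, ⊥, by intro v hv; exact absurd hv (by simp), by simp⟩
  have hbd : BddAbove {m : ℕ | ∃ M : G.Subgraph, M.IsMatching ∧ M.edgeSet.ncard = m} := by
    refine ⟨G.edgeSet.ncard, ?_⟩
    rintro m ⟨M, -, rfl⟩
    exact Set.ncard_le_ncard M.edgeSet_subset (Set.toFinite _)
  exact ⟨Nat.sSup_mem hne hbd, fun m hm => le_csSup hbd hm⟩

end SimpleGraph

/-! ### From homomorphism counts to subgraph counts. -/

namespace SimpleGraph

/-! Both graphs are disjoint unions of complete bipartite graphs with one side of a fixed size `X`.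
If a component of `K` with `s` vertices coloured `true` and `t` coloured `false` is mapped into such
a union, the choices number `X ^ t` times the `s`-th power sum of the other sizes. Components have
at most `k + 1` vertices, so size lists `a`, `b` with equal power sums up to exponent `k + 1` give
equal homomorphism counts (`card_hom_eq_of_power_sums`), hence equal subgraph counts
(`copyCount_eq_of_card_hom_eq`).

The matching number, however, adds up `min (a i) X`, which is far from polynomial. Lagrange
extrapolation to `1` from nodes at least `X`, with denominators cleared, yields lists where `a` has
only large sizes, while `b` has `N` ones and `m` large sizes, `X * m ≤ N`
(`exists_extrapolation_weights`). The matching numbers are `(N + m) * X` and `N + m * X ≤ 2 * N`, of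
ratio at least `X / 2`. -/

theorem labelledCopyCount_eq_natCard {V U : Type*} [Fintype V] [Fintype U]
    (G : SimpleGraph V) (K : SimpleGraph U) : G.labelledCopyCount K = Nat.card (Copy K G) := by
  classical
  rw [labelledCopyCount, Nat.card_eq_fintype_card]

/-- Every labelled copy of `K` in `G` is a subgraph of `G` isomorphic to `K` together with an
isomorphism onto it. -/
theorem labelledCopyCount_eq_copyCount_mul {V U : Type*} [Fintype V] [Fintype U]
    (G : SimpleGraph V) (K : SimpleGraph U) :
    G.labelledCopyCount K = G.copyCount K * Nat.card (K ≃g K) := by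
  classical
  let φ : (Σ S : {S : G.Subgraph // Nonempty (K ≃g S.coe)}, K ≃g S.1.coe) → Copy K G :=
    fun p => p.1.1.coeCopy.comp p.2.toCopy
  have hφ (p) (u : U) : φ p u = (p.2 u : V) := rfl
  have hsub (p) : (φ p).toSubgraph = p.1.1 := by
    obtain ⟨⟨S, hS⟩, e⟩ := p
    ext u v
    · simp only [Copy.toSubgraph, Subgraph.map_verts, Subgraph.verts_top, Set.image_univ,
        Set.mem_range, Copy.toHom_apply, hφ]
      exact ⟨fun ⟨w, hw⟩ => hw ▸ (e w).2, fun h => ⟨e.symm ⟨u, h⟩, by simp⟩⟩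
    · simp only [Copy.toSubgraph, Subgraph.map_adj, Relation.Map, Subgraph.top_adj,
        Copy.toHom_apply, hφ]
      constructor
      · rintro ⟨x, y, hxy, rfl, rfl⟩
        exact (e.map_rel_iff.2 hxy)
      · intro h
        refine ⟨e.symm ⟨u, S.edge_vert h⟩, e.symm ⟨v, S.edge_vert h.symm⟩, ?_, by simp, by simp⟩
        exact e.symm.map_rel_iff.2 h
  have hbij : Function.Bijective φ := by
    constructor
    · rintro ⟨S, e⟩ ⟨S', e'⟩ h
      obtain rfl : S = S' := Subtype.ext ((hsub ⟨S, e⟩).symm.trans (h ▸ hsub ⟨S', e'⟩))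
      congr 1
      ext u
      exact DFunLike.congr_fun h u
    · intro f
      refine ⟨⟨⟨f.toSubgraph, ⟨f.isoToSubgraph⟩⟩, f.isoToSubgraph⟩, ?_⟩
      ext u
      rfl
  have hiso (S : {S : G.Subgraph // Nonempty (K ≃g S.coe)}) :
      Nat.card (K ≃g S.1.coe) = Nat.card (K ≃g K) := by
    obtain ⟨e⟩ := S.2
    exact Nat.card_congr
      ⟨fun f => f.trans e.symm, fun f => f.trans e, fun f => by ext; simp, fun f => by ext; simp⟩
  have hfin : Finite (K ≃g K) := Finite.of_injective _ DFunLike.coe_injective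
  have hfin' (S : {S : G.Subgraph // Nonempty (K ≃g S.coe)}) : Finite (K ≃g S.1.coe) :=
    Finite.of_injective _ DFunLike.coe_injective
  calc G.labelledCopyCount K = Nat.card (Copy K G) := labelledCopyCount_eq_natCard G K
    _ = _ := by
      rw [← Nat.card_congr (Equiv.ofBijective φ hbij), Nat.card_sigma]
      simp only [hiso, Finset.sum_const, smul_eq_mul, Finset.card_univ]
      rw [copyCount, Fintype.card_subtype]

theorem copyCount_eq_of_labelledCopyCount_eq {V W U : Type*} [Fintype V] [Fintype W] [Fintype U]
    {G : SimpleGraph V} {H : SimpleGraph W} {K : SimpleGraph U}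
    (h : G.labelledCopyCount K = H.labelledCopyCount K) : G.copyCount K = H.copyCount K := by
  have hfin : Finite (K ≃g K) := Finite.of_injective _ DFunLike.coe_injective
  have : Nonempty (K ≃g K) := ⟨Iso.refl⟩
  rw [labelledCopyCount_eq_copyCount_mul, labelledCopyCount_eq_copyCount_mul] at h
  exact Nat.eq_of_mul_eq_mul_right Nat.card_pos h

/-- The homomorphisms with kernel `s` are the labelled copies of the quotient by `s`, if the
quotient has no loops. -/
theorem card_hom_ker_eq {V U : Type*} (G : SimpleGraph V) (K : SimpleGraph U) (s : Setoid U)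
    (hs : ∀ u v, K.Adj u v → ¬ s u v) :
    Nat.card {f : K →g G // Setoid.ker f = s} =
      Nat.card (Copy (K.map (Quotient.mk s)) G) := by
  symm
  let π : K →g K.map (Quotient.mk s) :=
    ⟨Quotient.mk s, fun {u v} h => ⟨fun he => hs u v h (Quotient.exact he), u, v, h, rfl, rfl⟩⟩
  let φ : Copy (K.map (Quotient.mk s)) G → {f : K →g G // Setoid.ker f = s} := fun c =>
    ⟨c.toHom.comp π, by
      ext u v
      rw [Setoid.ker_def]
      exact c.injective.eq_iff.trans Quotient.eq⟩
  refine Nat.card_congr (Equiv.ofBijective φ ⟨fun c d h => ?_, ?_⟩)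
  · ext q
    induction q using Quotient.ind with | _ u =>
    exact DFunLike.congr_fun (congrArg Subtype.val h) u
  · rintro ⟨f, rfl⟩
    refine ⟨⟨⟨Quotient.lift f fun _ _ h => h, ?_⟩, ?_⟩, rfl⟩
    · rintro _ _ ⟨-, u, v, h, rfl, rfl⟩
      exact f.map_adj h
    · intro p q
      induction p using Quotient.ind with | _ u =>
      induction q using Quotient.ind with | _ v =>
      exact fun h => Quotient.sound h

theorem card_hom_ker_eq_zero {V U : Type*} (G : SimpleGraph V) (K : SimpleGraph U) (s : Setoid U)
    {u v : U} (h : K.Adj u v) (hs : s u v) : Nat.card {f : K →g G // Setoid.ker f = s} = 0 := by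
  have : IsEmpty {f : K →g G // Setoid.ker f = s} :=
    ⟨fun ⟨f, hf⟩ => (f.map_adj h).ne (by rw [← hf] at hs; exact hs)⟩
  exact Nat.card_of_isEmpty

theorem card_hom_ker_bot {V U : Type*} (G : SimpleGraph V) (K : SimpleGraph U) :
    Nat.card {f : K →g G // Setoid.ker f = ⊥} = Nat.card (Copy K G) :=
  Nat.card_congr
    ⟨fun f => ⟨f.1, Setoid.ker_eq_bot_iff.1 f.2⟩,
      fun c => ⟨c.toHom, Setoid.ker_eq_bot_iff.2 c.injective⟩, fun _ => rfl, fun _ => rfl⟩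

instance {U : Type*} [Finite U] : Finite (Setoid U) :=
  Finite.of_injective (fun s : Setoid U => (s : U → U → Prop)) fun s t h => by
    ext u v
    exact iff_of_eq (congrFun (congrFun h u) v)

theorem ncard_edgeSet_map_le {U U' : Type*} [Finite U] (K : SimpleGraph U) (f : U → U') :
    (K.map f).edgeSet.ncard ≤ K.edgeSet.ncard := by
  have : (K.map f).edgeSet ⊆ Sym2.map f '' K.edgeSet := by
    intro e
    induction e using Sym2.ind with | _ x y =>
    rintro ⟨-, u, v, h, rfl, rfl⟩
    exact ⟨s(u, v), h, rfl⟩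
  exact (Set.ncard_le_ncard this (Set.toFinite _)).trans (Set.ncard_image_le (Set.toFinite _))

/-- Homomorphism counts from all graphs with at most `k` edges determine the numbers of labelled
copies of these graphs. -/
theorem card_copy_eq_of_card_hom_eq {V W : Type*} [Finite V] [Finite W]
    {G : SimpleGraph V} {H : SimpleGraph W} {k : ℕ}
    (h : ∀ (U : Type) [Fintype U] (K : SimpleGraph U), K.edgeSet.ncard ≤ k →
      Nat.card (K →g G) = Nat.card (K →g H)) :
    ∀ (n : ℕ) (U : Type) [Fintype U] (K : SimpleGraph U), Fintype.card U = n →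
      K.edgeSet.ncard ≤ k → Nat.card (Copy K G) = Nat.card (Copy K H) := by
  classical
  intro n
  induction n using Nat.strong_induction_on with | _ n ih =>
  rintro U _ K rfl hK
  have : Fintype (Setoid U) := Fintype.ofFinite _
  have hG : Finite (K →g G) := Finite.of_injective _ DFunLike.coe_injective
  have hH : Finite (K →g H) := Finite.of_injective _ DFunLike.coe_injective
  have key := h U K hK
  -- Sort homomorphisms by kernel. The kernel `⊥` gives the copies of `K`; any other gives copies of
  -- a quotient with fewer vertices and no more edges, or nothing if an edge would collapse.
  rw [← Nat.card_congr (Equiv.sigmaFiberEquiv fun f : K →g G => Setoid.ker f),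
    ← Nat.card_congr (Equiv.sigmaFiberEquiv fun f : K →g H => Setoid.ker f),
    Nat.card_sigma, Nat.card_sigma, ← Finset.add_sum_erase _ _ (Finset.mem_univ ⊥),
    ← Finset.add_sum_erase _ _ (Finset.mem_univ ⊥), card_hom_ker_bot, card_hom_ker_bot] at key
  refine Nat.add_right_cancel (key.trans (congrArg _ (Finset.sum_congr rfl fun s hs => ?_)))
  by_cases hl : ∀ u v, K.Adj u v → ¬ s u v
  · rw [card_hom_ker_eq _ _ _ hl, card_hom_ker_eq _ _ _ hl]
    refine (ih _ ?_ (Quotient s) _ rfl ((ncard_edgeSet_map_le _ _).trans hK)).symm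
    obtain ⟨u, v, huv, hne⟩ : ∃ u v, s u v ∧ u ≠ v := by
      by_contra! hc
      refine Finset.ne_of_mem_erase hs (eq_bot_iff.2 fun {u v} huv => hc u v huv)
    refine Fintype.card_lt_of_surjective_not_injective _ Quotient.mk_surjective fun hinj => ?_
    exact hne (hinj (Quotient.sound huv))
  · push Not at hl
    obtain ⟨u, v, huv, hs⟩ := hl
    rw [card_hom_ker_eq_zero _ _ _ huv hs, card_hom_ker_eq_zero _ _ _ huv hs]

theorem copyCount_eq_of_card_hom_eq {V W : Type*} [Fintype V] [Fintype W]
    {G : SimpleGraph V} {H : SimpleGraph W} {k : ℕ}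
    (h : ∀ (U : Type) [Fintype U] (K : SimpleGraph U), K.edgeSet.ncard ≤ k →
      Nat.card (K →g G) = Nat.card (K →g H))
    {U : Type} [Fintype U] (K : SimpleGraph U) (hK : K.edgeSet.ncard ≤ k) :
    G.copyCount K = H.copyCount K := by
  apply copyCount_eq_of_labelledCopyCount_eq
  rw [labelledCopyCount_eq_natCard, labelledCopyCount_eq_natCard]
  exact card_copy_eq_of_card_hom_eq h _ U K rfl hK

end SimpleGraph

/-! ### Disjoint unions of complete bipartite graphs: homomorphisms and matchings. -/

namespace SimpleGraph

/-- The disjoint union over `i` of the complete bipartite graphs with parts of sizes `n i true` and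
`n i false`. -/
def bipartiteUnion {I : Type*} (n : I → Bool → ℕ) :
    SimpleGraph (Σ p : I × Bool, Fin (n p.1 p.2)) where
  Adj u v := u.1.1 = v.1.1 ∧ u.1.2 ≠ v.1.2
  symm := ⟨fun _ _ h => ⟨h.1.symm, h.2.symm⟩⟩
  loopless := ⟨fun _ h => h.2 rfl⟩

theorem sigma_fin_ext {α : Type*} {f : α → ℕ} {u v : Σ a, Fin (f a)} (h : u.1 = v.1)
    (h' : (u.2 : ℕ) = v.2) : u = v := by
  obtain ⟨a, s⟩ := u
  obtain ⟨b, t⟩ := v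
  obtain rfl : a = b := h
  exact congrArg _ (Fin.ext h')

theorem sigma_pi_fin_ext {I S : Type*} {f : I → S → ℕ} {u v : Σ i, ∀ s, Fin (f i s)}
    (h : u.1 = v.1) (h' : ∀ s, (u.2 s : ℕ) = v.2 s) : u = v := by
  obtain ⟨a, s⟩ := u
  obtain ⟨b, t⟩ := v
  obtain rfl : a = b := h
  exact congrArg _ (funext fun s => Fin.ext (h' s))

/-- A homomorphism into a disjoint union of complete bipartite graphs is a proper `2`-colouring, a
choice of a bipartite graph for each component, and a choice of a vertex of the right side for each
vertex. -/
theorem card_hom_bipartiteUnion {I U : Type*} [Fintype I] [Fintype U] (n : I → Bool → ℕ)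
    (K : SimpleGraph U) [Fintype {σ : U → Bool // ∀ u v, K.Adj u v → σ u ≠ σ v}]
    [Fintype K.ConnectedComponent] [∀ C : K.ConnectedComponent, Fintype C.supp] :
    Nat.card (K →g bipartiteUnion n) =
      ∑ σ : {σ : U → Bool // ∀ u v, K.Adj u v → σ u ≠ σ v},
        ∏ C : K.ConnectedComponent, ∑ i : I, ∏ v : C.supp, n i (σ.1 v) := by
  let φ : (Σ σ : {σ : U → Bool // ∀ u v, K.Adj u v → σ u ≠ σ v},
      ∀ C : K.ConnectedComponent, Σ i : I, ∀ v : C.supp, Fin (n i (σ.1 v))) →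
      (K →g bipartiteUnion n) := fun q =>
    ⟨fun v => ⟨((q.2 (K.connectedComponentMk v)).1, q.1.1 v),
      (q.2 (K.connectedComponentMk v)).2 ⟨v, rfl⟩⟩, fun {u v} h =>
      ⟨by
        change (q.2 (K.connectedComponentMk u)).1 = (q.2 (K.connectedComponentMk v)).1
        rw [ConnectedComponent.sound h.reachable], q.1.2 u v h⟩⟩
  have hbij : Function.Bijective φ := by
    constructor
    · rintro ⟨σ, g⟩ ⟨τ, g'⟩ h
      have hpt (v : U) := DFunLike.congr_fun h v
      obtain rfl : σ = τ := Subtype.ext (funext fun v => congrArg (fun w => w.1.2) (hpt v))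
      congr 1
      funext C
      refine sigma_pi_fin_ext ?_ ?_
      · induction C using ConnectedComponent.ind with | _ v =>
        exact congrArg (fun w => w.1.1) (hpt v)
      · rintro ⟨v, rfl⟩
        exact congrArg (fun w => (w.2 : ℕ)) (hpt v)
    · intro f
      have hreach {u v : U} (h : K.Reachable u v) : (f u).1.1 = (f v).1.1 := by
        obtain ⟨p⟩ := h
        induction p with
        | nil => rfl
        | cons h _ ih => exact (f.map_adj h).1.trans ih
      have hC {C : K.ConnectedComponent} (v : C.supp) : (f v).1.1 = (f C.out).1.1 :=
        hreach (ConnectedComponent.exact (v.2.trans C.out_eq.symm))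
      refine ⟨⟨⟨fun v => (f v).1.2, fun u v h => (f.map_adj h).2⟩,
        fun C => ⟨(f C.out).1.1, fun v => ⟨(f v).2, ?_⟩⟩⟩, ?_⟩
      · rw [← hC v]
        exact (f v).2.2
      · ext1 v
        refine sigma_fin_ext (Prod.ext ?_ rfl) rfl
        exact (hC (C := K.connectedComponentMk v) ⟨v, rfl⟩).symm
  rw [← Nat.card_congr (Equiv.ofBijective φ hbij), Nat.card_sigma]
  simp [Nat.card_pi, Nat.card_sigma]

theorem ConnectedComponent.card_supp_le {U : Type*} [Finite U] {K : SimpleGraph U}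
    (C : K.ConnectedComponent) : Nat.card C.supp ≤ K.edgeSet.ncard + 1 := by
  refine C.connected_toSimpleGraph.card_vert_le_card_edgeSet_add_one.trans ?_
  have hinj : Function.Injective (Hom.mapEdgeSet C.toSimpleGraph_hom) :=
    Hom.mapEdgeSet.injective _ Subtype.val_injective
  rw [← Nat.card_coe_set_eq]
  exact Nat.add_le_add_right (Nat.card_le_card_of_injective _ hinj) 1

/-- The part sizes `a i` (side `true`) and `X` (side `false`). -/
def partSizes {I : Type*} (a : I → ℕ) (X : ℕ) (i : I) (b : Bool) : ℕ := if b then a i else X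

theorem card_hom_eq_of_power_sums {I J U : Type*} [Fintype I] [Fintype J] [Fintype U] {a : I → ℕ}
    {b : J → ℕ} {k : ℕ} (h : ∀ p ≤ k + 1, ∑ i, a i ^ p = ∑ j, b j ^ p) (X : ℕ)
    (K : SimpleGraph U) (hK : K.edgeSet.ncard ≤ k) :
    Nat.card (K →g bipartiteUnion (partSizes a X)) =
      Nat.card (K →g bipartiteUnion (partSizes b X)) := by
  classical
  rw [card_hom_bipartiteUnion, card_hom_bipartiteUnion]
  refine Finset.sum_congr rfl fun σ _ => Finset.prod_congr rfl fun C _ => ?_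
  simp only [partSizes, Finset.prod_ite, Finset.prod_const]
  rw [← Finset.sum_mul, ← Finset.sum_mul, h]
  have := C.card_supp_le
  rw [Nat.card_eq_fintype_card] at this
  exact (Finset.card_le_univ _).trans (by omega)

theorem card_le_matchingNumber {V ι : Type*} [Fintype V] [Fintype ι] {G : SimpleGraph V}
    {f g : ι → V} (hadj : ∀ i, G.Adj (f i) (g i)) (hf : f.Injective) (hg : g.Injective)
    (hfg : ∀ i j, f i ≠ g j) : Fintype.card ι ≤ G.matchingNumber := by
  have hM : (⨆ i, G.subgraphOfAdj (hadj i)).IsMatching := by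
    refine Subgraph.IsMatching.iSup (fun i => Subgraph.IsMatching.subgraphOfAdj _) ?_
    intro i j hij
    simp only [(Subgraph.IsMatching.subgraphOfAdj _).support_eq_verts,
      subgraphOfAdj_verts]
    have h1 := hf.ne hij
    have h2 := hg.ne hij
    have h3 := hfg i j
    have h4 := (hfg j i).symm
    simp [h1.symm, h2.symm, h3.symm, h4.symm]
  refine G.isGreatest_matchingNumber.2 ⟨_, hM, ?_⟩
  have : (⨆ i, G.subgraphOfAdj (hadj i)).edgeSet = Set.range fun i => s(f i, g i) := by
    ext e
    simp [Subgraph.edgeSet_iSup, eq_comm]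
  rw [this, ← Nat.card_coe_set_eq, Nat.card_range_of_injective, Nat.card_eq_fintype_card]
  intro i j hij
  rcases Sym2.eq_iff.1 hij with h | h
  · exact hf h.1
  · exact absurd h.1 (hfg i j)

/-- Matching edges are disjoint, so choosing a cover vertex on each is injective. -/
theorem matchingNumber_le_card_cover {V : Type*} [Fintype V] {G : SimpleGraph V} (c : Finset V)
    (hc : ∀ u v, G.Adj u v → u ∈ c ∨ v ∈ c) : G.matchingNumber ≤ c.card := by
  obtain ⟨M, hM, hcard⟩ := G.isGreatest_matchingNumber.1
  rw [← hcard, ← Set.ncard_coe_finset c]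
  have hex : ∀ e : M.edgeSet, ∃ v : c, v.1 ∈ e.1 := by
    rintro ⟨e, he⟩
    induction e using Sym2.ind with | _ u v =>
    rcases hc u v (M.adj_sub he) with h | h
    · exact ⟨⟨u, h⟩, by simp⟩
    · exact ⟨⟨v, h⟩, by simp⟩
  choose r hr using hex
  rw [← Nat.card_coe_set_eq, ← Nat.card_coe_set_eq]
  refine Nat.card_le_card_of_injective r ?_
  rintro ⟨e, he⟩ ⟨e', he'⟩ h
  have hu := hr ⟨e, he⟩
  have hu' := hr ⟨e', he'⟩
  rw [h] at hu
  generalize (r ⟨e', he'⟩ : V) = w at hu hu'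
  obtain ⟨u, rfl⟩ := hu
  obtain ⟨u', rfl⟩ := hu'
  have hu : u = u' := hM.eq_of_adj_left he he'
  subst hu
  rfl

theorem matchingNumber_bipartiteUnion {I : Type*} [Fintype I] (n : I → Bool → ℕ) :
    (bipartiteUnion n).matchingNumber = ∑ i, min (n i true) (n i false) := by
  classical
  let ι := Σ i, Fin (min (n i true) (n i false))
  have hι : Fintype.card ι = ∑ i, min (n i true) (n i false) := by simp [ι]
  have hmin (i : I) (b : Bool) : min (n i true) (n i false) ≤ n i b := by cases b <;> simp
  let f (b : I → Bool) (q : ι) : Σ p : I × Bool, Fin (n p.1 p.2) :=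
    ⟨(q.1, b q.1), Fin.castLE (hmin _ _) q.2⟩
  have hf (b) : (f b).Injective := fun q q' h =>
    sigma_fin_ext (congrArg (fun w => w.1.1) h) (congrArg (fun w => (w.2 : ℕ)) h)
  rw [← hι]
  apply le_antisymm
  · let b (i : I) : Bool := decide (n i true ≤ n i false)
    have hb (i : I) : n i (b i) = min (n i true) (n i false) := by
      by_cases h : n i true ≤ n i false
      · simp [b, h]
      · simp [b, h, le_of_not_ge h]
    have hmem (w : Σ p : I × Bool, Fin (n p.1 p.2)) (hw : w.1.2 = b w.1.1) :
        w ∈ Finset.univ.image (f b) := by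
      refine Finset.mem_image.2
        ⟨⟨w.1.1, ⟨w.2, ?_⟩⟩, Finset.mem_univ _, sigma_fin_ext (Prod.ext rfl hw.symm) rfl⟩
      rw [← hb, ← hw]
      exact w.2.2
    refine (matchingNumber_le_card_cover (Finset.univ.image (f b)) ?_).trans Finset.card_image_le
    rintro u v ⟨h, h'⟩
    by_cases hu : u.1.2 = b u.1.1
    · exact Or.inl (hmem u hu)
    · refine Or.inr (hmem v ?_)
      rw [← h]
      revert h' hu
      cases u.1.2 <;> cases v.1.2 <;> cases b u.1.1 <;> simp
  · exact card_le_matchingNumber (f := f fun _ => true) (g := f fun _ => false)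
      (fun q => ⟨rfl, by simp [f]⟩) (hf fun _ => true) (hf fun _ => false)
      fun q q' h => by simpa [f] using congrArg (fun w => w.1.2) h

end SimpleGraph

/-! ### Power sums: extrapolation from large nodes. -/

open Finset in
/-- Lagrange extrapolation to `1` from widely spaced nodes has little negative weight. -/
theorem exists_extrapolation_weights (D X : ℕ) :
    ∃ (x : Fin (D + 1) → ℕ) (c : Fin (D + 1) → ℤ) (N : ℕ), 0 < N ∧ (∀ i, X ≤ x i) ∧
      (∀ p ≤ D, ∑ i, c i * (x i : ℤ) ^ p = N) ∧ X * ∑ i, (-c i).toNat ≤ N := by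
  -- The last bound absorbs the `D + 1` negative parts, each at most `2 ^ D / M`, times `X`.
  obtain ⟨M, hM2, hMX, hMD⟩ : ∃ M : ℕ, 2 ≤ M ∧ X ≤ M ∧ X * ((D + 1) * 2 ^ D) ≤ M :=
    ⟨2 + X + X * ((D + 1) * 2 ^ D), by omega, by omega, by omega⟩
  let v : Fin (D + 1) → ℚ := fun i => (M : ℚ) ^ ((i : ℕ) + 1)
  have hMq : (2 : ℚ) ≤ M := by exact_mod_cast hM2
  have hM0 : (0 : ℚ) < M := by linarith
  have hM1 : (1 : ℚ) < M := by linarith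
  have hvlt {i j : Fin (D + 1)} (h : i < j) : (M : ℚ) * v i ≤ v j := by
    have : (M : ℚ) * v i = M ^ ((i : ℕ) + 2) := by simp only [v]; ring
    rw [this]
    exact pow_le_pow_right₀ hM1.le (by have := Fin.lt_def.1 h; omega)
  have hvM (i) : (M : ℚ) ≤ v i := by
    simpa using pow_le_pow_right₀ hM1.le (show 1 ≤ (i : ℕ) + 1 by omega)
  have hvlt' {i j : Fin (D + 1)} (h : i < j) : 2 * v i ≤ v j :=
    le_trans (mul_le_mul_of_nonneg_right hMq (by linarith [hvM i])) (hvlt h)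
  have hinj : Function.Injective v := by
    intro i j h
    rcases lt_trichotomy i j with hij | hij | hij
    · linarith [hvlt' hij, hvM i]
    · exact hij
    · linarith [hvlt' hij, hvM j]
  let L : Fin (D + 1) → ℚ := fun i => ∏ j ∈ univ.erase i, (1 - v j) / (v i - v j)
  have hsum (p : ℕ) (hp : p ≤ D) : ∑ i, L i * v i ^ p = 1 := by
    have h := Lagrange.eq_interpolate (s := univ) (v := v) (f := (Polynomial.X : Polynomial ℚ) ^ p)
      hinj.injOn (by simp only [Polynomial.degree_X_pow, card_univ, Fintype.card_fin]
                     exact_mod_cast Nat.lt_succ_of_le hp)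
    have h1 := congrArg (Polynomial.eval 1) h
    simp only [Lagrange.interpolate_apply, Polynomial.eval_finsetSum, Polynomial.eval_mul,
      Polynomial.eval_C, Polynomial.eval_pow, Polynomial.eval_X, one_pow] at h1
    rw [h1]
    refine sum_congr rfl fun i _ => ?_
    rw [mul_comm, Lagrange.basis, Polynomial.eval_prod]
    congr 1
    refine prod_congr rfl fun j _ => ?_
    simp only [Lagrange.basisDivisor, Polynomial.eval_mul, Polynomial.eval_C, Polynomial.eval_sub,
      Polynomial.eval_X]
    rw [div_eq_inv_mul]
  -- Nodes at least double, so `|v i - v j|` is at least `v j / 2`.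
  have hfac (i j : Fin (D + 1)) (hij : j ≠ i) : |(1 - v j) / (v i - v j)| ≤ 2 := by
    rw [abs_div, div_le_iff₀ (abs_pos.2 (sub_ne_zero.2 (hinj.ne hij.symm))),
      abs_of_nonpos (by linarith [hvM j] : 1 - v j ≤ 0)]
    rcases lt_or_gt_of_ne hij with h | h
    · rw [abs_of_nonneg] <;> linarith [hvlt' h, hvM j]
    · rw [abs_of_nonpos] <;> linarith [hvlt' h, hvM j, hvM i]
  have hL0 : 0 ≤ L 0 := by
    refine prod_nonneg fun j hj => div_nonneg_of_nonpos (by linarith [hvM j]) ?_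
    have := hvlt' (Fin.pos_iff_ne_zero.2 (ne_of_mem_erase hj))
    linarith [hvM 0]
  have hLi (i : Fin (D + 1)) (hi : i ≠ 0) : |L i| ≤ 2 ^ D / M := by
    have h0 : (0 : Fin (D + 1)) ∈ univ.erase i := mem_erase.2 ⟨hi.symm, mem_univ _⟩
    have hv0 : v 0 = M := by simp [v]
    -- The gain comes from the node `M` nearest to `1`: `v i ≥ M ^ 2` gives `v i - M ≥ M * (M - 1)`.
    have hfirst : |(1 - v 0) / (v i - v 0)| ≤ 1 / M := by
      have hlt := hvlt (Fin.pos_iff_ne_zero.2 hi)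
      rw [hv0] at hlt ⊢
      have hpos : (0 : ℚ) < v i - M := by nlinarith
      rw [abs_div, abs_of_pos hpos, abs_of_nonpos (by linarith), div_le_div_iff₀ hpos hM0]
      linarith
    have hrest : ∏ j ∈ (univ.erase i).erase 0, |(1 - v j) / (v i - v j)| ≤ 2 ^ D := by
      refine (prod_le_prod (fun _ _ => abs_nonneg _) fun j hj =>
        hfac i j (ne_of_mem_erase (mem_of_mem_erase hj))).trans ?_
      rw [prod_const]
      refine pow_le_pow_right₀ one_le_two ?_
      rw [card_erase_of_mem h0, card_erase_of_mem (mem_univ _), card_univ, Fintype.card_fin]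
      omega
    calc |L i| = |(1 - v 0) / (v i - v 0)| *
          ∏ j ∈ (univ.erase i).erase 0, |(1 - v j) / (v i - v j)| := by
            rw [abs_prod, ← mul_prod_erase _ _ h0]
      _ ≤ 1 / M * 2 ^ D := mul_le_mul hfirst hrest (prod_nonneg fun _ _ => abs_nonneg _)
            (by positivity)
      _ = 2 ^ D / M := by ring
  have hneg (i) : max (-L i) 0 ≤ 2 ^ D / M := by
    refine max_le ?_ (by positivity)
    by_cases hi : i = 0
    · subst hi
      exact (neg_nonpos.2 hL0).trans (by positivity)
    · exact (neg_le_abs _).trans (hLi i hi)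
  -- `N` is a common denominator of the weights.
  obtain ⟨N, hN, c, hc⟩ : ∃ N : ℕ, 0 < N ∧ ∃ c : Fin (D + 1) → ℤ, ∀ i, (c i : ℚ) = N * L i := by
    refine ⟨∏ i, (L i).den, prod_pos fun i _ => (L i).den_pos,
      fun i => (∏ j ∈ univ.erase i, ((L j).den : ℤ)) * (L i).num, fun i => ?_⟩
    rw [← mul_prod_erase _ _ (mem_univ i)]
    push_cast
    rw [mul_right_comm, mul_comm ((L i).den : ℚ), Rat.mul_den_eq_num, mul_comm]
  refine ⟨fun i => M ^ ((i : ℕ) + 1), c, N, hN, fun i => ?_, fun p hp => ?_, ?_⟩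
  · exact hMX.trans (Nat.le_self_pow (by omega) M)
  · have : ∑ i, (c i : ℚ) * v i ^ p = N := by
      simp only [hc, mul_assoc]
      rw [← mul_sum, hsum p hp, mul_one]
    simp only [v] at this
    exact_mod_cast this
  · have hNq : (0 : ℚ) < N := by exact_mod_cast hN
    have hcast (i) : (((-c i).toNat : ℕ) : ℚ) ≤ N * (2 ^ D / M) := by
      have h1 : (((-c i).toNat : ℕ) : ℚ) = max (-(c i : ℚ)) 0 := by
        have : (((-c i).toNat : ℕ) : ℤ) = max (-c i) 0 := Int.toNat_eq_max _
        exact_mod_cast congrArg (Int.cast : ℤ → ℚ) this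
      rw [h1, hc, ← mul_neg, ← mul_zero (N : ℚ), ← mul_max_of_nonneg _ _ hNq.le]
      exact mul_le_mul_of_nonneg_left (hneg i) hNq.le
    have hS : (X : ℚ) * ∑ i, (((-c i).toNat : ℕ) : ℚ) ≤ N := by
      calc (X : ℚ) * ∑ i, (((-c i).toNat : ℕ) : ℚ)
          ≤ X * ∑ _i : Fin (D + 1), (N : ℚ) * (2 ^ D / M) :=
            mul_le_mul_of_nonneg_left (sum_le_sum fun i _ => hcast i) (by positivity)
        _ = N * ((X * ((D + 1) * 2 ^ D) : ℕ) / M) := by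
            simp only [sum_const, card_univ, Fintype.card_fin, nsmul_eq_mul]
            push_cast
            ring
        _ ≤ N * 1 := by
            refine mul_le_mul_of_nonneg_left ((div_le_one hM0).2 ?_) hNq.le
            exact_mod_cast hMD
        _ = N := mul_one _
    exact_mod_cast hS

/-! ### Assembling the two graphs. -/

theorem mainTheorem6 (lam : ℝ) (hlam : 1 < lam) (k : ℕ) :
    ∃ (V W : Type) (_ : Fintype V) (_ : Fintype W) (G : SimpleGraph V) (H : SimpleGraph W),
      0 < H.matchingNumber ∧
      lam * (H.matchingNumber : ℝ) ≤ (G.matchingNumber : ℝ) ∧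
      ∀ (U : Type) [Fintype U] (K : SimpleGraph U), K.edgeSet.ncard ≤ k →
        G.copyCount K = H.copyCount K := by
  obtain ⟨X, hX⟩ := exists_nat_ge (2 * lam)
  have hX1 : 1 ≤ X := by
    have : (0 : ℝ) < X := by linarith
    exact_mod_cast this
  obtain ⟨x, c, N, hN, hx, hsum, hneg⟩ := exists_extrapolation_weights (k + 1) X
  -- Positive weights become multiplicities in `a`; negative ones move across to `b`, next to the
  -- `N` copies of the target node `1`.
  let a : (Σ i, Fin (c i).toNat) → ℕ := fun q => x q.1
  let b : (Fin N ⊕ Σ i, Fin (-c i).toNat) → ℕ := Sum.elim (fun _ => 1) fun q => x q.1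
  have hpow : ∀ p ≤ k + 1, ∑ q, a q ^ p = ∑ q, b q ^ p := by
    intro p hp
    have h := hsum p hp
    simp only [a, b, Fintype.sum_sigma, Fintype.sum_sum_type, Sum.elim_inl, Sum.elim_inr, one_pow,
      Finset.sum_const, Finset.card_univ, Fintype.card_fin, smul_eq_mul, mul_one]
    zify
    rw [← h, ← Finset.sum_add_distrib]
    refine Finset.sum_congr rfl fun i _ => ?_
    rw [← add_mul]
    congr 1
    omega
  have hG : (SimpleGraph.bipartiteUnion (SimpleGraph.partSizes a X)).matchingNumber =
      (N + ∑ i, (-c i).toNat) * X := by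
    rw [SimpleGraph.matchingNumber_bipartiteUnion]
    -- Exponent `0` says that both unions have equally many pieces.
    have h0 := hpow 0 (Nat.zero_le _)
    simp only [pow_zero, Finset.sum_const, Finset.card_univ, smul_eq_mul, mul_one,
      Fintype.card_sum, Fintype.card_sigma, Fintype.card_fin] at h0
    simp [SimpleGraph.partSizes, a, hx, h0]
  have hH : (SimpleGraph.bipartiteUnion (SimpleGraph.partSizes b X)).matchingNumber =
      N + (∑ i, (-c i).toNat) * X := by
    rw [SimpleGraph.matchingNumber_bipartiteUnion]
    simp [SimpleGraph.partSizes, b, hx, hX1, Finset.sum_mul]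
  refine ⟨_, _, inferInstance, inferInstance,
    SimpleGraph.bipartiteUnion (SimpleGraph.partSizes a X),
    SimpleGraph.bipartiteUnion (SimpleGraph.partSizes b X), ?_, ?_, fun U _ K hK =>
    SimpleGraph.copyCount_eq_of_card_hom_eq
      (fun U _ K hK => SimpleGraph.card_hom_eq_of_power_sums hpow X K hK) K hK⟩
  · rw [hH]
    omega
  · rw [hG, hH]
    generalize ∑ i, (-c i).toNat = m at hneg
    have hneg' : (X : ℝ) * m ≤ N := by exact_mod_cast hneg
    push_cast
    have hN0 : (0 : ℝ) ≤ N := Nat.cast_nonneg _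
    have hm0 : (0 : ℝ) ≤ m * X := by positivity
    calc lam * ((N : ℝ) + m * X) ≤ lam * (2 * N) :=
          mul_le_mul_of_nonneg_left (by linarith) (by linarith)
      _ = 2 * lam * N := by ring
      _ ≤ X * N := mul_le_mul_of_nonneg_right hX hN0
      _ ≤ (N + m) * X := by linarith
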